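/- An interior algebra is a Boolean algebra $B$ with an operator $g$ satisfying $g(1)=1$, $g(a\cdot b)=g(a)\cdot g(b)$, $g(a)\le a$ and $g(g(a))=g(a)$; $a$ is open if $g(a)=a$. The open elements of $B$ form a Heyting algebra $\mathcal O(B)$, a bounded sublattice of $B$ with implication $a\Rightarrow b=g(-a+b)$. $B$ is a $^*$-algebra if it is generated by its open elements, and a Grzegorczyk algebra if $g\bigl(x+f(x\cdot -g(x))\bigr)\le x$ for all $x\in B$, where $f(y)=-g(-y)$. A variety $\mathbf V$ of interior algebras is a $^*$-variety if it is generated, as a variety, by the $^*$-algebras it contains, and it is locally finite if finitely generated subalgebras of its members are finite. Let $\gamma(\mathbf V)$ be the class of all Heyting algebras isomorphic to $\mathcal O(B)$ for some $B\in\mathbf V$. Let $\mathbf K$ be $\mathbf V$ or $\gamma(\mathbf V)$, and let $A\in\mathbf K$ be finitely presented relative to $\mathbf K$. A unifier for $A$ in $\mathbf K$ is a homomorphism $u\colon A\to P$ with $P\in\mathbf K$ finitely presented and projective in $\mathbf K$ (projective with respect to surjective homomorphisms in $\mathbf K$). A unifier $u\colon A\to P$ is more general than $v\colon A\to Q$ if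 $v=h\circ u$ for some homomorphism $h\colon P\to Q$. $A$ is unifiable if it has a unifier. A $\mu$-set is a set $M$ of pairwise incomparable unifiers for $A$ such that for each unifier for $A$ some member of $M$ is more general than it. A unifiable $A$ has type $1$, $\omega$, $\infty$ or $0$ according to whether it has a $\mu$-set of cardinality $1$, a finite $\mu$-set of cardinality greater than $1$, an infinite $\mu$-set, or no $\mu$-set. With the order $1<\omega<\infty<0$, the unification type $t(\mathbf K)$ is the maximum of the types of the unifiable $A\in\mathbf K$. **Theorem.** Let $\mathbf V$ be a locally finite variety of interior algebras. Then $\mathbf V$ is a $^*$-variety if and only if all its members are Grzegorczyk algebras; and if $\mathbf V$ is a $^*$-variety, then $t(\mathbf V)=t(\gamma(\mathbf V))$. -/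

import Mathlib

open CategoryTheory

universe u

/-! ### Unification types of quasi-ordered sets -/

/-- The four unification types `1`, `ω`, `∞`, `0`. -/
inductive UnificationType : Type
  | unitary
  | finitary
  | infinitary
  | nullary

section Quasiorder

variable {P : Type*} [Preorder P]

/-- A `μ`-set of a quasi-ordered set: an antichain `M` which is dense, that is, each element
lies below some element of `M`. -/
def IsMuSet (M : Set P) : Prop :=
  IsAntichain (· ≤ ·) M ∧ ∀ x : P, ∃ m ∈ M, x ≤ m

/-- The quasi-ordered set `P` has the given unification type. -/
def QuasiorderHasType (P : Type*) [Preorder P] : UnificationType → Prop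
  | .unitary => ∃ M : Set P, IsMuSet M ∧ M.ncard = 1
  | .finitary => ∃ M : Set P, IsMuSet M ∧ M.Finite ∧ 1 < M.ncard
  | .infinitary => ∃ M : Set P, IsMuSet M ∧ M.Infinite
  | .nullary => ¬ ∃ M : Set P, IsMuSet M

theorem IsMuSet.exists_injective {M N : Set P} (hM : IsMuSet M) (hN : IsMuSet N) :
    ∃ f : N → M, Function.Injective f := by
  choose f hfM hf using fun n : N => hM.2 n
  refine ⟨fun n => ⟨f n, hfM n⟩, fun a b hab => ?_⟩
  have hab' : f a = f b := congrArg Subtype.val hab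
  obtain ⟨c, hc, hfc⟩ := hN.2 (f a)
  have h1 : (a : P) = c := hN.1.eq a.2 hc ((hf a).trans hfc)
  have h2 : (b : P) = c := hN.1.eq b.2 hc ((hf b).trans (hab' ▸ hfc))
  exact Subtype.ext (h1.trans h2.symm)

theorem IsMuSet.finite_of_finite {M N : Set P} (hM : IsMuSet M) (hN : IsMuSet N)
    (h : M.Finite) : N.Finite := by
  obtain ⟨f, hf⟩ := hM.exists_injective hN
  have := h.to_subtype
  exact Set.finite_coe_iff.1 (Finite.of_injective f hf)

theorem IsMuSet.ncard_le {M N : Set P} (hM : IsMuSet M) (hN : IsMuSet N)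
    (h : M.Finite) : N.ncard ≤ M.ncard := by
  obtain ⟨f, hf⟩ := hM.exists_injective hN
  have := h.to_subtype
  exact Nat.card_le_card_of_injective f hf

theorem QuasiorderHasType.unique {s t : UnificationType}
    (hs : QuasiorderHasType P s) (ht : QuasiorderHasType P t) : s = t := by
  cases s <;> cases t <;> simp only [QuasiorderHasType] at hs ht <;> first
    | rfl
    | (obtain ⟨M, hM, h⟩ := hs; exact absurd ⟨M, hM⟩ ht)
    | (obtain ⟨M, hM, h⟩ := ht; exact absurd ⟨M, hM⟩ hs)
    | (exfalso
       obtain ⟨M, hM, h⟩ := hs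
       obtain ⟨N, hN, k⟩ := ht
       first
        | (have := hM.ncard_le hN (Set.finite_of_ncard_ne_zero (by omega)); omega)
        | (have := hN.ncard_le hM (Set.finite_of_ncard_ne_zero (by omega)); omega)
        | exact k (hM.finite_of_finite hN (Set.finite_of_ncard_ne_zero (by omega)))
        | exact h (hN.finite_of_finite hM (Set.finite_of_ncard_ne_zero (by omega))))

theorem QuasiorderHasType.exists [Nonempty P] : ∃ t, QuasiorderHasType P t := by
  by_cases h : ∃ M : Set P, IsMuSet M
  · obtain ⟨M, hM⟩ := h
    by_cases hf : M.Finite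
    · have hne : M.Nonempty := by
        obtain ⟨m, hm, -⟩ := hM.2 (Classical.arbitrary P)
        exact ⟨m, hm⟩
      have hpos := (Set.ncard_pos hf).2 hne
      by_cases h1 : M.ncard = 1
      · exact ⟨.unitary, M, hM, h1⟩
      · exact ⟨.finitary, M, hM, hf, by omega⟩
    · exact ⟨.infinitary, M, hM, hf⟩
  · exact ⟨.nullary, h⟩

end Quasiorder

/-! ### Algebraic unification, for classes of algebras in a concrete category of algebras -/

/-- Terms over sets of variables, with their evaluation in the algebras of a concrete category. -/
class HasTerms (C : Type (u + 1)) [Category.{u} C] {FC : outParam (C → C → Type u)}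
    {CC : outParam (C → Type u)} [outParam (∀ X Y, FunLike (FC X Y) (CC X) (CC Y))]
    [ConcreteCategory C FC] where
  Term : Type → Type
  eval : (A : C) → {X : Type} → (X → CC A) → Term X → CC A

section Unification

variable {C : Type (u + 1)} [Category.{u} C] {FC : C → C → Type u} {CC : C → Type u}
  [∀ X Y, FunLike (FC X Y) (CC X) (CC Y)] [ConcreteCategory C FC]

/-- `P` is projective in the class `V`: `P` belongs to `V`, and each homomorphism from `P` to a
member of `V` lifts along each surjective homomorphism between members of `V`. -/
def IsProjectiveIn (V : Set C) (P : C) : Prop :=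
  P ∈ V ∧ ∀ A ∈ V, ∀ B ∈ V, ∀ (e : A ⟶ B) (f : P ⟶ B),
    Function.Surjective (ConcreteCategory.hom e) → ∃ g : P ⟶ A, g ≫ e = f

variable [HasTerms C]

/-- The tuple `a` satisfies all equations of `E`. -/
def Satisfies (A : C) {X : Type} (a : X → CC A)
    (E : Set (HasTerms.Term C X × HasTerms.Term C X)) : Prop :=
  ∀ p ∈ E, HasTerms.eval A a p.1 = HasTerms.eval A a p.2

/-- `A` is finitely presented relative to `V`: it belongs to `V` and is the algebra presented in
`V` by finitely many generators `a 0, …, a (n - 1)` and a finite set `E` of relations. -/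
def IsFinitelyPresentedIn (V : Set C) (A : C) : Prop :=
  A ∈ V ∧ ∃ (n : ℕ) (E : Set (HasTerms.Term C (Fin n) × HasTerms.Term C (Fin n)))
    (a : Fin n → CC A), E.Finite ∧ Satisfies A a E ∧
      ∀ B ∈ V, ∀ b : Fin n → CC B, Satisfies B b E →
        ∃! h : A ⟶ B, ∀ i, ConcreteCategory.hom h (a i) = b i

/-- A unifier for `A` in `V`: a homomorphism from `A` to an algebra which is finitely presented
and projective in `V`. -/
structure Unifier (V : Set C) (A : C) where
  target : C
  finitelyPresented : IsFinitelyPresentedIn V target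
  projective : IsProjectiveIn V target
  hom : A ⟶ target

/-- The quasi-order of unifiers: `u ≤ v` if `v` is more general than `u`, that is, if `u`
factors through `v`. -/
instance (V : Set C) (A : C) : Preorder (Unifier V A) where
  le u v := ∃ h : v.target ⟶ u.target, v.hom ≫ h = u.hom
  le_refl u := ⟨𝟙 _, Category.comp_id _⟩
  le_trans := by
    rintro u v w ⟨h, hh⟩ ⟨k, hk⟩
    exact ⟨k ≫ h, by rw [← Category.assoc, hk, hh]⟩

/-- `A` is unifiable relative to `V`; this is only considered for algebras `A` which are finitely
presented relative to `V`. -/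
def IsUnifiableIn (V : Set C) (A : C) : Prop :=
  IsFinitelyPresentedIn V A ∧ Nonempty (Unifier V A)

/-- The class `V` has the given unification type. -/
def HasUnificationType (V : Set C) : UnificationType → Prop
  | .unitary => ∀ A, IsUnifiableIn V A → QuasiorderHasType (Unifier V A) .unitary
  | .finitary =>
      (∀ A, IsUnifiableIn V A → QuasiorderHasType (Unifier V A) .unitary ∨
        QuasiorderHasType (Unifier V A) .finitary) ∧
      ∃ A, IsUnifiableIn V A ∧ QuasiorderHasType (Unifier V A) .finitary
  | .infinitary =>
      (∀ A, IsUnifiableIn V A → QuasiorderHasType (Unifier V A) .unitary ∨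
        QuasiorderHasType (Unifier V A) .finitary ∨
        QuasiorderHasType (Unifier V A) .infinitary) ∧
      ∃ A, IsUnifiableIn V A ∧ QuasiorderHasType (Unifier V A) .infinitary
  | .nullary => ∃ A, IsUnifiableIn V A ∧ QuasiorderHasType (Unifier V A) .nullary

theorem HasUnificationType.existsUnique (V : Set C) : ∃! t, HasUnificationType V t := by
  have ex : ∀ A, IsUnifiableIn V A → ∃ t, QuasiorderHasType (Unifier V A) t := fun A hA =>
    haveI := hA.2
    QuasiorderHasType.exists
  have un : ∀ A s t, QuasiorderHasType (Unifier V A) s → QuasiorderHasType (Unifier V A) t →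
      s = t := fun A s t h k => h.unique k
  refine existsUnique_of_exists_of_unique ?_ ?_
  · by_cases h0 : HasUnificationType V .nullary
    · exact ⟨_, h0⟩
    by_cases h1 : ∃ A, IsUnifiableIn V A ∧ QuasiorderHasType (Unifier V A) .infinitary
    · refine ⟨.infinitary, fun A hA => ?_, h1⟩
      obtain ⟨t, ht⟩ := ex A hA
      cases t
      · exact Or.inl ht
      · exact Or.inr (Or.inl ht)
      · exact Or.inr (Or.inr ht)
      · exact absurd ⟨A, hA, ht⟩ h0
    by_cases h2 : ∃ A, IsUnifiableIn V A ∧ QuasiorderHasType (Unifier V A) .finitary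
    · refine ⟨.finitary, fun A hA => ?_, h2⟩
      obtain ⟨t, ht⟩ := ex A hA
      cases t
      · exact Or.inl ht
      · exact Or.inr ht
      · exact absurd ⟨A, hA, ht⟩ h1
      · exact absurd ⟨A, hA, ht⟩ h0
    · refine ⟨.unitary, fun A hA => ?_⟩
      obtain ⟨t, ht⟩ := ex A hA
      cases t
      · exact ht
      · exact absurd ⟨A, hA, ht⟩ h2
      · exact absurd ⟨A, hA, ht⟩ h1
      · exact absurd ⟨A, hA, ht⟩ h0
  · intro s t hs ht
    cases s <;> cases t <;> simp only [HasUnificationType] at hs ht <;> grind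

/-- The unification type `t(V)` of the class `V`. -/
noncomputable def unificationType (V : Set C) : UnificationType :=
  Classical.choose (HasUnificationType.existsUnique V).exists

theorem unificationType_eq_iff (V : Set C) (t : UnificationType) :
    unificationType V = t ↔ HasUnificationType V t :=
  have h := Classical.choose_spec (HasUnificationType.existsUnique V).exists
  ⟨fun e => e ▸ h, fun k => (HasUnificationType.existsUnique V).unique h k⟩

end Unification

/-! ### Terms in the language of Heyting algebras -/

inductive HeytTerm (X : Type) : Type
  | var : X → HeytTerm X
  | bot : HeytTerm X
  | top : HeytTerm X
  | inf : HeytTerm X → HeytTerm X → HeytTerm X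
  | sup : HeytTerm X → HeytTerm X → HeytTerm X
  | imp : HeytTerm X → HeytTerm X → HeytTerm X

def HeytTerm.eval {L : Type u} [HeytingAlgebra L] {X : Type} (a : X → L) : HeytTerm X → L
  | .var x => a x
  | .bot => ⊥
  | .top => ⊤
  | .inf s t => s.eval a ⊓ t.eval a
  | .sup s t => s.eval a ⊔ t.eval a
  | .imp s t => s.eval a ⇨ t.eval a

instance : HasTerms HeytAlg.{u} where
  Term := HeytTerm
  eval _ _ a t := HeytTerm.eval a t

/-! ### Interior algebras -/

/-- An interior algebra: a Boolean algebra with an interior operator. -/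
class InteriorAlgebra (B : Type u) extends BooleanAlgebra B where
  int : B → B
  int_top : int ⊤ = ⊤
  int_inf : ∀ a b, int (a ⊓ b) = int a ⊓ int b
  int_le : ∀ a, int a ≤ a
  int_int : ∀ a, int (int a) = int a

/-- Homomorphisms of interior algebras. -/
@[ext]
structure InteriorHom (A B : Type u) [InteriorAlgebra A] [InteriorAlgebra B] where
  toFun : A → B
  map_bot : toFun ⊥ = ⊥
  map_top : toFun ⊤ = ⊤
  map_inf : ∀ a b, toFun (a ⊓ b) = toFun a ⊓ toFun b
  map_sup : ∀ a b, toFun (a ⊔ b) = toFun a ⊔ toFun b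
  map_compl : ∀ a, toFun aᶜ = (toFun a)ᶜ
  map_int : ∀ a, toFun (InteriorAlgebra.int a) = InteriorAlgebra.int (toFun a)

instance (A B : Type u) [InteriorAlgebra A] [InteriorAlgebra B] :
    FunLike (InteriorHom A B) A B where
  coe f := f.toFun
  coe_injective _ _ h := InteriorHom.ext h

/-- The category `IA` of interior algebras. -/
structure IntAlg : Type (u + 1) where
  carrier : Type u
  [str : InteriorAlgebra carrier]

attribute [instance] IntAlg.str

instance : CoeSort IntAlg.{u} (Type u) := ⟨IntAlg.carrier⟩

instance : Category.{u} IntAlg.{u} where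
  Hom A B := InteriorHom A B
  id _ :=
    { toFun := id
      map_bot := rfl
      map_top := rfl
      map_inf := fun _ _ => rfl
      map_sup := fun _ _ => rfl
      map_compl := fun _ => rfl
      map_int := fun _ => rfl }
  comp f g :=
    { toFun := g.toFun ∘ f.toFun
      map_bot := by simp [f.map_bot, g.map_bot]
      map_top := by simp [f.map_top, g.map_top]
      map_inf := by simp [f.map_inf, g.map_inf]
      map_sup := by simp [f.map_sup, g.map_sup]
      map_compl := by simp [f.map_compl, g.map_compl]
      map_int := by simp [f.map_int, g.map_int] }

instance : ConcreteCategory IntAlg.{u} (fun A B => InteriorHom A B) where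
  hom f := f
  ofHom f := f
  hom_ofHom _ := rfl
  ofHom_hom _ := rfl
  id_apply _ := rfl
  comp_apply _ _ _ := rfl

inductive IntTerm (X : Type) : Type
  | var : X → IntTerm X
  | bot : IntTerm X
  | top : IntTerm X
  | inf : IntTerm X → IntTerm X → IntTerm X
  | sup : IntTerm X → IntTerm X → IntTerm X
  | compl : IntTerm X → IntTerm X
  | int : IntTerm X → IntTerm X

def IntTerm.eval {B : Type u} [InteriorAlgebra B] {X : Type} (a : X → B) : IntTerm X → B
  | .var x => a x
  | .bot => ⊥
  | .top => ⊤
  | .inf s t => s.eval a ⊓ t.eval a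
  | .sup s t => s.eval a ⊔ t.eval a
  | .compl t => (t.eval a)ᶜ
  | .int t => InteriorAlgebra.int (t.eval a)

instance : HasTerms IntAlg.{u} where
  Term := IntTerm
  eval _ _ a t := IntTerm.eval a t

/-- Direct products of interior algebras, with all operations computed coordinatewise. -/
instance {I : Type u} (B : I → Type u) [∀ i, InteriorAlgebra (B i)] :
    InteriorAlgebra (∀ i, B i) where
  int a i := InteriorAlgebra.int (a i)
  int_top := funext fun _ => InteriorAlgebra.int_top
  int_inf _ _ := funext fun _ => InteriorAlgebra.int_inf _ _
  int_le _ _ := InteriorAlgebra.int_le _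
  int_int _ := funext fun _ => InteriorAlgebra.int_int _

namespace InteriorAlgebra

variable {B : Type u} [InteriorAlgebra B]

/-- `S` is (the universe of) a subalgebra of the interior algebra `B`. -/
structure IsSubalgebra (S : Set B) : Prop where
  bot_mem : ⊥ ∈ S
  top_mem : ⊤ ∈ S
  inf_mem : ∀ a ∈ S, ∀ b ∈ S, a ⊓ b ∈ S
  sup_mem : ∀ a ∈ S, ∀ b ∈ S, a ⊔ b ∈ S
  compl_mem : ∀ a ∈ S, aᶜ ∈ S
  int_mem : ∀ a ∈ S, int a ∈ S

/-- The subalgebra generated by `s`. -/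
def generated (s : Set B) : Set B := ⋂₀ {S | IsSubalgebra S ∧ s ⊆ S}

theorem int_mono {a b : B} (h : a ≤ b) : int a ≤ int b := by
  have := int_inf a b
  rw [inf_eq_left.2 h] at this
  exact inf_eq_left.1 this.symm

/-- The set of open elements. -/
def opens (B : Type u) [InteriorAlgebra B] : Set B := {a | int a = a}

theorem int_mem_opens (a : B) : int a ∈ opens B := int_int a

theorem sup_mem_opens {a b : B} (ha : a ∈ opens B) (hb : b ∈ opens B) : a ⊔ b ∈ opens B := by
  refine le_antisymm (int_le _) (sup_le ?_ ?_)
  · calc a = int a := ha.symm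
      _ ≤ int (a ⊔ b) := int_mono le_sup_left
  · calc b = int b := hb.symm
      _ ≤ int (a ⊔ b) := int_mono le_sup_right

theorem inf_mem_opens {a b : B} (ha : a ∈ opens B) (hb : b ∈ opens B) : a ⊓ b ∈ opens B := by
  change int (a ⊓ b) = a ⊓ b
  rw [int_inf, show int a = a from ha, show int b = b from hb]

/-- The Heyting algebra of open elements: a bounded sublattice of `B`, with the implication
`a ⇨ b = int (aᶜ ⊔ b)`. -/
instance : HeytingAlgebra (opens B) where
  __ := (inferInstance : PartialOrder (opens B))
  sup a b := ⟨(a : B) ⊔ (b : B), sup_mem_opens a.2 b.2⟩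
  inf a b := ⟨(a : B) ⊓ (b : B), inf_mem_opens a.2 b.2⟩
  le_sup_left a b := (le_sup_left : (a : B) ≤ (a : B) ⊔ (b : B))
  le_sup_right a b := (le_sup_right : (b : B) ≤ (a : B) ⊔ (b : B))
  sup_le a b c h k := (sup_le h k : (a : B) ⊔ b ≤ c)
  inf_le_left a b := (inf_le_left : (a : B) ⊓ b ≤ a)
  inf_le_right a b := (inf_le_right : (a : B) ⊓ b ≤ b)
  le_inf a b c h k := (le_inf h k : (a : B) ≤ (b : B) ⊓ (c : B))
  top := ⟨⊤, int_top⟩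
  le_top a := (le_top : (a : B) ≤ ⊤)
  bot := ⟨⊥, le_antisymm (int_le _) bot_le⟩
  bot_le a := (bot_le : ⊥ ≤ (a : B))
  himp a b := ⟨int ((a : B)ᶜ ⊔ b), int_mem_opens _⟩
  le_himp_iff a b c := by
    change (a : B) ≤ int ((b : B)ᶜ ⊔ c) ↔ (a : B) ⊓ b ≤ c
    have key : (a : B) ≤ (b : B)ᶜ ⊔ c ↔ (a : B) ⊓ b ≤ c := by
      rw [sup_comm, ← himp_eq, le_himp_iff]
    rw [← key]
    refine ⟨fun h => h.trans (int_le _), fun h => ?_⟩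
    calc (a : B) = int (a : B) := a.2.symm
      _ ≤ _ := int_mono h
  compl a := ⟨int (a : B)ᶜ, int_mem_opens _⟩
  himp_bot a := Subtype.ext (congrArg int (sup_bot_eq (a : B)ᶜ))

/-- `B` is a `*`-algebra: it is generated by its open elements. -/
def IsStarAlgebra (B : Type u) [InteriorAlgebra B] : Prop := generated (opens B) = Set.univ

/-- `B` is a Grzegorczyk algebra: `int (x ⊔ cl (x ⊓ (int x)ᶜ)) ≤ x` for all `x`, where
`cl y = (int yᶜ)ᶜ` is the closure operator. -/
def IsGrzegorczyk (B : Type u) [InteriorAlgebra B] : Prop :=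
  ∀ x : B, int (x ⊔ (int (x ⊓ (int x)ᶜ)ᶜ)ᶜ) ≤ x

end InteriorAlgebra

namespace IntAlg

open InteriorAlgebra

/-- A variety of interior algebras: a class closed under homomorphic images, (isomorphic copies
of) subalgebras and direct products. -/
structure IsVariety (V : Set IntAlg.{u}) : Prop where
  image_mem : ∀ A ∈ V, ∀ (B : IntAlg.{u}) (f : A ⟶ B),
    Function.Surjective (ConcreteCategory.hom f) → B ∈ V
  sub_mem : ∀ A ∈ V, ∀ (B : IntAlg.{u}) (f : B ⟶ A),
    Function.Injective (ConcreteCategory.hom f) → B ∈ V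
  prod_mem : ∀ (I : Type u) (A : I → IntAlg.{u}), (∀ i, A i ∈ V) →
    (⟨∀ i, A i⟩ : IntAlg.{u}) ∈ V

/-- The variety generated by the class `K`. -/
def varietyGenerated (K : Set IntAlg.{u}) : Set IntAlg.{u} :=
  ⋂₀ {W | IsVariety W ∧ K ⊆ W}

/-- `V` is a `*`-variety: it is generated by the `*`-algebras it contains. -/
def IsStarVariety (V : Set IntAlg.{u}) : Prop :=
  IsVariety V ∧ V = varietyGenerated {A | A ∈ V ∧ IsStarAlgebra A}

/-- `V` is locally finite: finitely generated subalgebras of its members are finite. -/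
def IsLocallyFinite (V : Set IntAlg.{u}) : Prop :=
  ∀ A ∈ V, ∀ s : Set A, s.Finite → (generated s).Finite

/-- The Heyting algebra `O(A)` of open elements of `A`. -/
def openAlgebra (A : IntAlg.{u}) : HeytAlg.{u} := HeytAlg.of (opens A)

/-- The class `γ(V) = O[V]` of Heyting algebras (closed under isomorphism). -/
def gamma (V : Set IntAlg.{u}) : Set HeytAlg.{u} :=
  {L | ∃ A ∈ V, Nonempty (L ≅ openAlgebra A)}

end IntAlg

/-! The link between `*`-algebras and the Grzegorczyk inequality is topological. In a `*`-algebra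
every nonzero element has a nonzero relatively open part on which a given `x` is decided, since such
`x` form a subalgebra containing the open elements. A failure of the inequality at `x` gives a part
of `x` and a part of its complement with the same nonzero closure, so neither can be avoided on a
relatively open part of that closure. Conversely, in a finite Grzegorczyk algebra each atom is a
difference of two closed elements, so the open elements generate everything.

The Grzegorczyk inequality is an equation, hence passes from the `*`-algebras of a `*`-variety to
all its members. Conversely, in a locally finite variety of Grzegorczyk algebras each element lies
in a finite subalgebra, which is a `*`-algebra. Hence every member is a `*`-algebra, which is more
than being a `*`-variety demands.

Once all members of `V` are `*`-algebras, passing to open elements is fully faithful on `V`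
(`openHom_injective`, `openHom_surjective`), preserves and reflects surjections, and reaches every
algebra of `γ(V)` up to isomorphism. On both sides finitely presented means finite, by local
finiteness, and finiteness also transfers. So projectivity, unifiers and the quasi-order of unifiers
correspond, and the unification types agree. -/

namespace InteriorAlgebra

/-! ### Closure, `*`-algebras and the Grzegorczyk inequality -/

section

variable {B : Type u} [InteriorAlgebra B]

theorem bot_mem_opens : (⊥ : B) ∈ opens B := le_antisymm (int_le _) bot_le

theorem top_mem_opens : (⊤ : B) ∈ opens B := int_top

theorem isSubalgebra_generated (s : Set B) : IsSubalgebra (generated s) where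
  bot_mem := fun _ h => h.1.bot_mem
  top_mem := fun _ h => h.1.top_mem
  inf_mem := fun a ha b hb S h => h.1.inf_mem a (ha S h) b (hb S h)
  sup_mem := fun a ha b hb S h => h.1.sup_mem a (ha S h) b (hb S h)
  compl_mem := fun a ha S h => h.1.compl_mem a (ha S h)
  int_mem := fun a ha S h => h.1.int_mem a (ha S h)

theorem subset_generated (s : Set B) : s ⊆ generated s := fun _ ha _ h => h.2 ha

theorem generated_subset {s S : Set B} (hS : IsSubalgebra S) (h : s ⊆ S) : generated s ⊆ S :=
  fun _ ha => ha S ⟨hS, h⟩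

theorem IsStarAlgebra.mem_of_opens_subset (hB : IsStarAlgebra B) {S : Set B}
    (hS : IsSubalgebra S) (h : opens B ⊆ S) (x : B) : x ∈ S :=
  generated_subset hS h (hB ▸ Set.mem_univ x)

/-- The closure operator. -/
def cl (x : B) : B := (int xᶜ)ᶜ

theorem le_cl (x : B) : x ≤ cl x := le_compl_comm.1 (int_le _)

theorem cl_mono {x y : B} (h : x ≤ y) : cl x ≤ cl y :=
  compl_le_compl (int_mono (compl_le_compl h))

theorem cl_cl (x : B) : cl (cl x) = cl x := by simp only [cl, compl_compl, int_int]

theorem cl_bot : cl (⊥ : B) = ⊥ := by simp only [cl, compl_bot, int_top, compl_top]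

theorem cl_le_cl {x y : B} (h : x ≤ cl y) : cl x ≤ cl y := (cl_mono h).trans (cl_cl y).le

/-- An open element meets the closure of `x` inside the closure of its meet with `x`. -/
theorem inf_cl_le {u : B} (hu : u ∈ opens B) (x : B) : u ⊓ cl x ≤ cl (u ⊓ x) := by
  rw [cl, cl, ← le_himp_iff', himp_eq, ← compl_inf]
  refine compl_le_compl ?_
  calc int (u ⊓ x)ᶜ ⊓ u = int ((u ⊓ x)ᶜ ⊓ u) := by rw [int_inf, show int u = u from hu]
    _ ≤ int xᶜ := int_mono (by
      rw [compl_inf, inf_sup_right, compl_inf_self, bot_sup_eq]; exact inf_le_left)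

/-- An element of a `*`-algebra is decided on some relatively open part of each nonzero element. -/
theorem IsStarAlgebra.exists_open_decides (hB : IsStarAlgebra B) (x : B) :
    ∀ e : B, e ≠ ⊥ → ∃ v ∈ opens B, e ⊓ v ≠ ⊥ ∧ (e ⊓ v ≤ x ∨ e ⊓ v ≤ xᶜ) := by
  -- An open `x` is decided on the part `e ⊓ x`, or on all of `e` when that part vanishes.
  have hopen : ∀ x ∈ opens B, ∀ e : B, e ≠ ⊥ →
      ∃ v ∈ opens B, e ⊓ v ≠ ⊥ ∧ (e ⊓ v ≤ x ∨ e ⊓ v ≤ xᶜ) := by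
    intro x hx e he
    by_cases h : e ⊓ x = ⊥
    · exact ⟨⊤, top_mem_opens, by simpa using he,
        Or.inr (by simpa using (disjoint_iff.2 h).le_compl_right)⟩
    · exact ⟨x, hx, h, Or.inl inf_le_right⟩
  have hcompl : ∀ x : B, (∀ e : B, e ≠ ⊥ →
      ∃ v ∈ opens B, e ⊓ v ≠ ⊥ ∧ (e ⊓ v ≤ x ∨ e ⊓ v ≤ xᶜ)) → ∀ e : B, e ≠ ⊥ →
      ∃ v ∈ opens B, e ⊓ v ≠ ⊥ ∧ (e ⊓ v ≤ xᶜ ∨ e ⊓ v ≤ xᶜᶜ) := by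
    intro x hx e he
    obtain ⟨v, hv, h0, h⟩ := hx e he
    exact ⟨v, hv, h0, by rw [compl_compl]; exact h.symm⟩
  have hinf : ∀ x y : B, (∀ e : B, e ≠ ⊥ →
      ∃ v ∈ opens B, e ⊓ v ≠ ⊥ ∧ (e ⊓ v ≤ x ∨ e ⊓ v ≤ xᶜ)) → (∀ e : B, e ≠ ⊥ →
      ∃ v ∈ opens B, e ⊓ v ≠ ⊥ ∧ (e ⊓ v ≤ y ∨ e ⊓ v ≤ yᶜ)) → ∀ e : B, e ≠ ⊥ →
      ∃ v ∈ opens B, e ⊓ v ≠ ⊥ ∧ (e ⊓ v ≤ x ⊓ y ∨ e ⊓ v ≤ (x ⊓ y)ᶜ) := by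
    intro x y hx hy e he
    obtain ⟨v, hv, h0, h | h⟩ := hx e he
    · obtain ⟨w, hw, h1, k⟩ := hy _ h0
      refine ⟨v ⊓ w, inf_mem_opens hv hw, by rwa [← inf_assoc], ?_⟩
      rw [← inf_assoc]
      exact k.imp (fun k => le_inf (inf_le_left.trans h) k)
        fun k => k.trans (compl_le_compl inf_le_right)
    · exact ⟨v, hv, h0, Or.inr (h.trans (compl_le_compl inf_le_left))⟩
  -- Closure under `int` costs nothing, because `int a` is open whatever `a` is.
  refine hB.mem_of_opens_subset (S := {x | ∀ e : B, e ≠ ⊥ →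
    ∃ v ∈ opens B, e ⊓ v ≠ ⊥ ∧ (e ⊓ v ≤ x ∨ e ⊓ v ≤ xᶜ)}) ?_ hopen x
  exact
    { bot_mem := hopen _ bot_mem_opens
      top_mem := hopen _ top_mem_opens
      inf_mem := fun a ha b hb => hinf a b ha hb
      sup_mem := fun a ha b hb => by
        have := hcompl _ (hinf _ _ (hcompl a ha) (hcompl b hb))
        rwa [compl_inf, compl_compl, compl_compl] at this
      compl_mem := hcompl
      int_mem := fun a _ => hopen _ (int_mem_opens a) }

/-- If the inequality fails at `x`, then `p = y ⊓ xᶜ` is nonzero, while `y ⊓ q` lies below `x`.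
Since `y` is open, each of the two lies in the closure of the other. Both are therefore dense in `cl
p`, and `x` cannot be decided on any relatively open part of `cl p`. -/
theorem IsStarAlgebra.isGrzegorczyk (hB : IsStarAlgebra B) : IsGrzegorczyk B := by
  intro x
  set q := x ⊓ (int x)ᶜ with hq
  set y := int (x ⊔ cl q) with hy
  have hyo : y ∈ opens B := int_mem_opens _
  change y ≤ x
  by_contra hyx
  set p := y ⊓ xᶜ with hp
  have hp0 : p ≠ ⊥ := fun h => hyx (by simpa using (disjoint_iff.2 h).le_compl_right)
  have hpq : p ≤ cl (y ⊓ q) := by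
    refine le_trans (le_inf inf_le_left ?_) (inf_cl_le hyo q)
    calc p ≤ (x ⊔ cl q) ⊓ xᶜ := inf_le_inf_right _ (int_le _)
      _ = cl q ⊓ xᶜ := by rw [inf_sup_right, inf_compl_self, bot_sup_eq]
      _ ≤ cl q := inf_le_left
  have hqp : y ⊓ q ≤ cl p := by
    refine le_trans (inf_le_inf_left y ?_) (inf_cl_le hyo xᶜ)
    rw [cl, compl_compl]
    exact inf_le_right
  have hc : cl (y ⊓ q) = cl p := le_antisymm (cl_le_cl hqp) (cl_le_cl hpq)
  obtain ⟨v, hv, h0, h⟩ := hB.exists_open_decides x (cl p)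
    fun h => hp0 (le_bot_iff.1 (h ▸ le_cl p))
  -- An element dense in `cl p` meets the nonzero relatively open part `cl p ⊓ v`: an open `v`
  -- disjoint from `z` is disjoint from `cl z`.
  have key : ∀ z : B, z ≤ cl p → cl p ≤ cl z → Disjoint (cl p ⊓ v) z → False := by
    intro z h1 h2 hd
    have h3 : v ⊓ z = ⊥ := by
      have : v ⊓ z ≤ cl p ⊓ v ⊓ z := by
        refine le_inf (le_inf (inf_le_right.trans h1) inf_le_left) inf_le_right
      rwa [hd.eq_bot, le_bot_iff] at this
    have h4 := inf_cl_le hv z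
    rw [h3, cl_bot, le_bot_iff] at h4
    exact h0 (le_bot_iff.1 (h4 ▸ le_inf inf_le_right (inf_le_left.trans h2)))
  rcases h with h | h
  · exact key p (le_cl p) le_rfl
      (disjoint_compl_right.mono h (inf_le_right : p ≤ xᶜ))
  · exact key (y ⊓ q) hqp hc.ge
      (disjoint_compl_left.mono h (inf_le_right.trans inf_le_left : y ⊓ q ≤ x))

/-- For an atom `a`, put `q = cl a ⊓ aᶜ`. The inequality at `aᶜ` forces `a` to be disjoint from `cl
q`, so `a = cl a ⊓ (cl q)ᶜ` is generated by open elements; finite joins of atoms give the rest. -/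
theorem IsGrzegorczyk.isStarAlgebra_of_finite [Finite B] (hB : IsGrzegorczyk B) :
    IsStarAlgebra B := by
  have hG := isSubalgebra_generated (opens B)
  have hcl : ∀ x : B, cl x ∈ generated (opens B) := fun x =>
    hG.compl_mem _ (subset_generated _ (int_mem_opens _))
  have hatom : ∀ a : B, IsAtom a → a ∈ generated (opens B) := by
    intro a ha
    set q := cl a ⊓ aᶜ with hq
    have hdisj : Disjoint a (cl q) := by
      -- Otherwise the atom `a` lies below `cl q`, so `cl a = cl q`. Then the left side of the
      -- inequality at `aᶜ` is `int (aᶜ ⊔ cl a) = ⊤`, forcing `a = ⊥`.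
      rw [← ha.not_le_iff_disjoint]
      intro h
      have h1 : cl a = cl q := le_antisymm (cl_le_cl h) (cl_le_cl inf_le_left)
      have h2 := hB aᶜ
      have h3 : (aᶜ ⊓ (int aᶜ)ᶜ : B) = q := inf_comm _ _
      change int (aᶜ ⊔ cl (aᶜ ⊓ (int aᶜ)ᶜ)) ≤ aᶜ at h2
      have h4 : aᶜ ⊔ cl a = ⊤ := by
        rw [eq_top_iff, ← compl_sup_eq_top (x := a)]
        exact sup_le_sup_left (le_cl a) _
      rw [h3, ← h1, h4, int_top, top_le_iff, compl_eq_top] at h2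
      exact ha.1 h2
    have h1 : a = cl a ⊓ (cl q)ᶜ := by
      refine le_antisymm (le_inf (le_cl a) hdisj.le_compl_right) ?_
      calc cl a ⊓ (cl q)ᶜ ≤ cl a ⊓ qᶜ := inf_le_inf_left _ (compl_le_compl (le_cl q))
        _ = cl a ⊓ a := by rw [hq, compl_inf, compl_compl, inf_sup_left, inf_compl_self,
              bot_sup_eq]
        _ ≤ a := inf_le_right
    rw [h1]
    exact hG.inf_mem _ (hcl a) _ (hG.compl_mem _ (hcl q))
  refine Set.eq_univ_of_forall fun x => ?_
  induction x using WellFoundedLT.induction with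
  | ind x ih =>
    rcases eq_bot_or_exists_atom_le x with rfl | ⟨a, ha, hax⟩
    · exact hG.bot_mem
    · have hlt : x \ a < x := sdiff_lt hax ha.1
      rw [← sdiff_sup_cancel hax]
      exact hG.sup_mem _ (ih _ hlt) _ (hatom a ha)

/-- A subalgebra as a Boolean subalgebra. -/
def IsSubalgebra.toBooleanSubalgebra {S : Set B} (hS : IsSubalgebra S) : BooleanSubalgebra B where
  carrier := S
  supClosed' := fun a ha b hb => hS.sup_mem a ha b hb
  infClosed' := fun a ha b hb => hS.inf_mem a ha b hb
  compl_mem' := fun ha => hS.compl_mem _ ha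
  bot_mem' := hS.bot_mem

/-- A subalgebra as an interior algebra. -/
def IsSubalgebra.toIntAlg {S : Set B} (hS : IsSubalgebra S) : IntAlg.{u} where
  carrier := hS.toBooleanSubalgebra
  str :=
    { int := fun a => ⟨int (a : B), hS.int_mem _ a.2⟩
      int_top := Subtype.ext int_top
      int_inf := fun _ _ => Subtype.ext (int_inf _ _)
      int_le := fun a => int_le (a : B)
      int_int := fun _ => Subtype.ext (int_int _) }

end

/-- The inclusion of a subalgebra. -/
def IsSubalgebra.incl {B : IntAlg.{u}} {S : Set B} (hS : IsSubalgebra S) : hS.toIntAlg ⟶ B :=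
  show InteriorHom _ _ from
  { toFun := fun a => a.1
    map_bot := rfl
    map_top := rfl
    map_inf := fun _ _ => rfl
    map_sup := fun _ _ => rfl
    map_compl := fun _ => rfl
    map_int := fun _ => rfl }

theorem IsSubalgebra.incl_injective {B : IntAlg.{u}} {S : Set B} (hS : IsSubalgebra S) :
    Function.Injective (ConcreteCategory.hom hS.incl) := fun _ _ h => Subtype.ext h

/-! ### Homomorphisms and their restrictions to open elements -/

section

variable {A B : Type u} [InteriorAlgebra A] [InteriorAlgebra B]

theorem IsSubalgebra.preimage {S : Set B} (hS : IsSubalgebra S) (f : InteriorHom A B) :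
    IsSubalgebra (f.toFun ⁻¹' S) where
  bot_mem := by simpa [f.map_bot] using hS.bot_mem
  top_mem := by simpa [f.map_top] using hS.top_mem
  inf_mem a ha b hb := by simpa [f.map_inf] using hS.inf_mem _ ha _ hb
  sup_mem a ha b hb := by simpa [f.map_sup] using hS.sup_mem _ ha _ hb
  compl_mem a ha := by simpa [f.map_compl] using hS.compl_mem _ ha
  int_mem a ha := by simpa [f.map_int] using hS.int_mem _ ha

theorem isSubalgebra_range (f : InteriorHom A B) : IsSubalgebra (Set.range f.toFun) where
  bot_mem := ⟨_, f.map_bot⟩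
  top_mem := ⟨_, f.map_top⟩
  inf_mem := by rintro _ ⟨a, rfl⟩ _ ⟨b, rfl⟩; exact ⟨_, f.map_inf a b⟩
  sup_mem := by rintro _ ⟨a, rfl⟩ _ ⟨b, rfl⟩; exact ⟨_, f.map_sup a b⟩
  compl_mem := by rintro _ ⟨a, rfl⟩; exact ⟨_, f.map_compl a⟩
  int_mem := by rintro _ ⟨a, rfl⟩; exact ⟨_, f.map_int a⟩

theorem isSubalgebra_eqLocus (f g : InteriorHom A B) :
    IsSubalgebra {a | f.toFun a = g.toFun a} where
  bot_mem := by simp [f.map_bot, g.map_bot]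
  top_mem := by simp [f.map_top, g.map_top]
  inf_mem a ha b hb := by simp_all [f.map_inf, g.map_inf]
  sup_mem a ha b hb := by simp_all [f.map_sup, g.map_sup]
  compl_mem a ha := by simp_all [f.map_compl, g.map_compl]
  int_mem a ha := by simp_all [f.map_int, g.map_int]

theorem map_mem_opens (f : InteriorHom A B) {a : A} (ha : a ∈ opens A) : f.toFun a ∈ opens B :=
  (f.map_int a).symm.trans (congrArg f.toFun ha)

/-- A homomorphism of interior algebras restricts to the Heyting algebras of open elements. -/
def openHom (f : InteriorHom A B) : HeytingHom (opens A) (opens B) where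
  toFun a := ⟨f.toFun a, map_mem_opens f a.2⟩
  map_sup' _ _ := Subtype.ext (f.map_sup _ _)
  map_inf' _ _ := Subtype.ext (f.map_inf _ _)
  map_bot' := Subtype.ext f.map_bot
  map_himp' a b := Subtype.ext <| by
    change f.toFun (int ((a : A)ᶜ ⊔ b)) = int ((f.toFun a)ᶜ ⊔ f.toFun b)
    rw [f.map_int, f.map_sup, f.map_compl]

theorem openHom_injective (hA : IsStarAlgebra A) {f g : InteriorHom A B}
    (h : openHom f = openHom g) : f = g := by
  refine InteriorHom.ext (funext fun a => ?_)
  exact hA.mem_of_opens_subset (isSubalgebra_eqLocus f g)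
    (fun b hb => congrArg Subtype.val (DFunLike.congr_fun h (⟨b, hb⟩ : opens A))) a

theorem coe_finset_inf_opens {ι : Type*} (t : Finset ι) (f : ι → opens A) :
    ((t.inf f : opens A) : A) = t.inf fun i => (f i : A) := by
  classical
  induction t using Finset.induction with
  | empty => rfl
  | insert i t hi ih => rw [Finset.inf_insert, Finset.inf_insert, ← ih]; rfl

theorem int_finset_inf {ι : Type*} (t : Finset ι) (f : ι → A) :
    int (t.inf f) = t.inf fun i => int (f i) := by
  classical
  induction t using Finset.induction with
  | empty => exact int_top
  | insert i t hi ih => rw [Finset.inf_insert, Finset.inf_insert, int_inf, ih]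

/-- The graph of a map between the algebras of open elements. -/
def openGraph (φ : HeytingHom (opens A) (opens B)) : Set (A × B) :=
  Set.range fun a : opens A => ((a : A), (φ a : B))

/-- The graph is a bounded sublattice of `A × B`, so its Boolean closure consists of finite joins of
differences. -/
theorem mem_closure_openGraph_iff (φ : HeytingHom (opens A) (opens B)) (p : A × B) :
    p ∈ BooleanSubalgebra.closure (openGraph φ) ↔
      ∃ t : Finset (openGraph φ × openGraph φ), p = t.sup fun x => x.1.1 \ x.2.1 := by
  refine BooleanSubalgebra.mem_closure_iff_sup_sdiff ⟨?_, ?_⟩ ?_ ?_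
  · rintro _ ⟨a, rfl⟩ _ ⟨b, rfl⟩
    exact ⟨a ⊔ b, by simp only [map_sup]; rfl⟩
  · rintro _ ⟨a, rfl⟩ _ ⟨b, rfl⟩
    exact ⟨a ⊓ b, by simp only [map_inf]; rfl⟩
  · exact ⟨⊥, by simp only [map_bot]; rfl⟩
  · exact ⟨⊤, by simp only [map_top]; rfl⟩

/-- In the normal form each difference `a \ b` vanishes in the first coordinate, so `a ≤ b`;
monotonicity of `φ` makes it vanish in the second. This is what makes the closure single-valued. -/
theorem snd_eq_bot_of_mem_closure_openGraph (φ : HeytingHom (opens A) (opens B)) {y : B}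
    (h : ((⊥ : A), y) ∈ BooleanSubalgebra.closure (openGraph φ)) : y = ⊥ := by
  obtain ⟨t, ht⟩ := (mem_closure_openGraph_iff φ _).1 h
  have h1 : ∀ x ∈ t, x.1.1 \ x.2.1 ≤ ((⊥ : A), y) := fun x hx => by
    rw [ht]; exact Finset.le_sup (f := fun x : openGraph φ × openGraph φ => x.1.1 \ x.2.1) hx
  suffices ((⊥ : A), y) ≤ ⊥ from le_bot_iff.1 this.2
  rw [ht]
  refine Finset.sup_le fun x hx => ?_
  obtain ⟨⟨_, ⟨a, rfl⟩⟩, ⟨_, ⟨b, rfl⟩⟩⟩ := x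
  have h2 : (a : A) ≤ b := sdiff_eq_bot_iff.1 (le_bot_iff.1 (h1 _ hx).1)
  have h3 : (φ a : B) ≤ φ b := OrderHomClass.mono φ (show a ≤ b from h2)
  exact ⟨(sdiff_eq_bot_iff.2 h2).le, (sdiff_eq_bot_iff.2 h3).le⟩

/-- Write `p` as a finite meet of terms `aᶜ ⊔ b` with `a`, `b` in the graph. Since `int` preserves
finite meets and turns such a term into `a ⇨ b`, which `φ` preserves, the result lies in the graph
itself. -/
theorem int_mem_closure_openGraph (φ : HeytingHom (opens A) (opens B)) {p : A × B}
    (h : p ∈ BooleanSubalgebra.closure (openGraph φ)) :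
    (int p.1, int p.2) ∈ BooleanSubalgebra.closure (openGraph φ) := by
  -- The normal form is applied to `pᶜ`, so that `p` becomes a meet, which `int` respects.
  obtain ⟨t, ht⟩ := (mem_closure_openGraph_iff φ _).1 (BooleanSubalgebra.compl_mem h)
  choose a ha using fun x : openGraph φ => x.2
  have h1 : p = t.inf fun x => (x.1.1 \ x.2.1)ᶜ := by
    rw [← compl_compl p, ht, Finset.compl_sup]
  have hf : p.1 = t.inf fun x => ((a x.1 : A)ᶜ ⊔ a x.2) := by
    rw [h1]
    trans t.inf fun x => ((x.1.1 \ x.2.1)ᶜ).1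
    · exact Finset.apply_inf_eq_inf_comp Prod.fst (fun _ _ => rfl) rfl
    · refine Finset.inf_congr rfl fun x _ => ?_
      rw [← ha x.1, ← ha x.2]
      change ((a x.1 : A) \ a x.2)ᶜ = _
      rw [compl_sdiff, himp_eq, sup_comm]
  have hs : p.2 = t.inf fun x => ((φ (a x.1) : B)ᶜ ⊔ φ (a x.2)) := by
    rw [h1]
    trans t.inf fun x => ((x.1.1 \ x.2.1)ᶜ).2
    · exact Finset.apply_inf_eq_inf_comp Prod.snd (fun _ _ => rfl) rfl
    · refine Finset.inf_congr rfl fun x _ => ?_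
      rw [← ha x.1, ← ha x.2]
      change ((φ (a x.1) : B) \ φ (a x.2))ᶜ = _
      rw [compl_sdiff, himp_eq, sup_comm]
  refine BooleanSubalgebra.subset_closure ⟨t.inf fun x => a x.1 ⇨ a x.2, Prod.ext ?_ ?_⟩
  · change ((t.inf fun x => a x.1 ⇨ a x.2 : opens A) : A) = int p.1
    rw [hf, coe_finset_inf_opens, int_finset_inf]
    rfl
  · change ((φ (t.inf fun x => a x.1 ⇨ a x.2) : opens B) : B) = int p.2
    rw [hs, int_finset_inf, map_finset_inf, coe_finset_inf_opens]
    refine Finset.inf_congr rfl fun x _ => ?_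
    simp only [Function.comp, map_himp]
    rfl

/-- A Heyting homomorphism between the algebras of open elements extends to the interior algebras
if the domain is a `*`-algebra. -/
theorem openHom_surjective (hA : IsStarAlgebra A) (φ : HeytingHom (opens A) (opens B)) :
    ∃ f : InteriorHom A B, openHom f = φ := by
  -- `G` is to be the graph of the extension: total because its first coordinates form a subalgebra
  -- containing the open elements, and single-valued by subtracting two pairs with equal first
  -- coordinate.
  set G := BooleanSubalgebra.closure (openGraph φ) with hG
  have hmem : ∀ a : opens A, ((a : A), (φ a : B)) ∈ G := fun a =>
    BooleanSubalgebra.subset_closure ⟨a, rfl⟩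
  have htot : ∀ a : A, ∃ b : B, (a, b) ∈ G := by
    refine hA.mem_of_opens_subset (S := {a | ∃ b : B, (a, b) ∈ G}) ?_ fun a ha =>
      ⟨_, hmem ⟨a, ha⟩⟩
    exact
      { bot_mem := ⟨⊥, G.bot_mem⟩
        top_mem := ⟨⊤, G.top_mem⟩
        inf_mem := by rintro a ⟨x, hx⟩ b ⟨y, hy⟩; exact ⟨x ⊓ y, G.inf_mem hx hy⟩
        sup_mem := by rintro a ⟨x, hx⟩ b ⟨y, hy⟩; exact ⟨x ⊔ y, G.sup_mem hx hy⟩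
        compl_mem := by rintro a ⟨x, hx⟩; exact ⟨xᶜ, G.compl_mem hx⟩
        int_mem := by rintro a ⟨x, hx⟩; exact ⟨int x, int_mem_closure_openGraph φ hx⟩ }
  have hle : ∀ (a : A) (x y : B), (a, x) ∈ G → (a, y) ∈ G → x ≤ y := by
    intro a x y hx hy
    have h : (a \ a, x \ y) ∈ G := G.sdiff_mem hx hy
    rw [sdiff_self] at h
    exact sdiff_eq_bot_iff.1 (snd_eq_bot_of_mem_closure_openGraph φ h)
  have huniq : ∀ {a : A} {x y : B}, (a, x) ∈ G → (a, y) ∈ G → x = y := fun hx hy =>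
    le_antisymm (hle _ _ _ hx hy) (hle _ _ _ hy hx)
  choose f hf using htot
  refine ⟨⟨f, huniq (hf _) G.bot_mem, huniq (hf _) G.top_mem,
    fun a b => huniq (hf _) (G.inf_mem (hf a) (hf b)),
    fun a b => huniq (hf _) (G.sup_mem (hf a) (hf b)),
    fun a => huniq (hf _) (G.compl_mem (hf a)),
    fun a => huniq (hf _) (int_mem_closure_openGraph φ (hf a))⟩, ?_⟩
  exact DFunLike.ext _ _ fun a : opens A => Subtype.ext (huniq (hf a) (hmem a))

theorem openHom_surjective_iff (hB : IsStarAlgebra B) (f : InteriorHom A B) :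
    Function.Surjective (openHom f) ↔ Function.Surjective f.toFun := by
  refine ⟨fun h b => ?_, fun h b => ?_⟩
  · refine hB.mem_of_opens_subset (isSubalgebra_range f) (fun c hc => ?_) b
    obtain ⟨a, ha⟩ := h ⟨c, hc⟩
    exact ⟨a, congrArg Subtype.val ha⟩
  · obtain ⟨a, ha⟩ := h b
    -- A preimage of an open element can be replaced by its interior.
    exact ⟨⟨int a, int_mem_opens a⟩, Subtype.ext ((f.map_int a).trans (by rw [ha]; exact b.2))⟩

end

end InteriorAlgebra

/-! ### Varieties of Grzegorczyk algebras -/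

namespace IntAlg

open InteriorAlgebra

theorem map_grzegorczyk {A B : IntAlg.{u}} (f : A ⟶ B) (x : A) :
    f.toFun (int (x ⊔ (int (x ⊓ (int x)ᶜ)ᶜ)ᶜ) ⊓ x) =
      int (f.toFun x ⊔ (int (f.toFun x ⊓ (int (f.toFun x))ᶜ)ᶜ)ᶜ) ⊓ f.toFun x := by
  simp only [f.map_int, f.map_sup, f.map_compl, f.map_inf]

theorem isVariety_isGrzegorczyk : IsVariety {A : IntAlg.{u} | IsGrzegorczyk A} where
  image_mem A hA B f hf y := by
    obtain ⟨x, rfl⟩ := hf y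
    exact inf_eq_left.1 <| (map_grzegorczyk f x).symm.trans <| by
      rw [inf_eq_left.2 (hA x)]
      simp only [f.map_int, f.map_sup, f.map_compl, f.map_inf]
      rfl
  sub_mem A hA B f hf x := by
    refine inf_eq_left.1 (hf ?_)
    refine (map_grzegorczyk f x).trans ((inf_eq_left.2 (hA (f.toFun x))).trans ?_)
    change _ = f.toFun _
    simp only [f.map_int, f.map_sup, f.map_compl, f.map_inf]
  prod_mem I A h x i := h i (x i)

variable {V : Set IntAlg.{u}}

theorem IsStarVariety.isGrzegorczyk (hV : IsStarVariety V) : ∀ A ∈ V, IsGrzegorczyk A := by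
  intro A hA
  rw [hV.2] at hA
  exact hA _ ⟨isVariety_isGrzegorczyk, fun B hB => hB.2.isGrzegorczyk⟩

/-- Each `x` lies in the finite subalgebra it generates, which is a `*`-algebra; the open elements
of that subalgebra are open in `A`. -/
theorem IsVariety.isStarAlgebra (hV : IsVariety V) (hfin : IsLocallyFinite V)
    (h : ∀ A ∈ V, IsGrzegorczyk A) : ∀ A ∈ V, IsStarAlgebra A := by
  intro A hA
  refine Set.eq_univ_of_forall fun x S hS => ?_
  have hT := isSubalgebra_generated ({x} : Set A)
  have hTV : hT.toIntAlg ∈ V := hV.sub_mem A hA _ hT.incl hT.incl_injective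
  have : Finite hT.toIntAlg := (hfin A hA {x} (Set.finite_singleton x)).to_subtype
  exact (h _ hTV).isStarAlgebra_of_finite.mem_of_opens_subset (hS.1.preimage hT.incl)
    (fun a ha => hS.2 (map_mem_opens hT.incl ha)) ⟨x, subset_generated _ rfl⟩

theorem IsVariety.isStarVariety (hV : IsVariety V) (h : ∀ A ∈ V, IsStarAlgebra A) :
    IsStarVariety V := by
  refine ⟨hV, Set.Subset.antisymm (fun A hA W hW => hW.2 ⟨hA, h A hA⟩) fun A hA => ?_⟩
  exact hA V ⟨hV, fun B hB => hB.1⟩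

end IntAlg

/-! ### Invariance of unification types -/

section Quasiorder

variable {P Q : Type*} [Preorder P] [Preorder Q]

theorem IsMuSet.image {f : P → Q} (hf : ∀ x y, x ≤ y ↔ f x ≤ f y)
    (hs : ∀ q, ∃ p, q ≤ f p ∧ f p ≤ q) {M : Set P} (hM : IsMuSet M) : IsMuSet (f '' M) := by
  refine ⟨?_, fun q => ?_⟩
  · rintro _ ⟨x, hx, rfl⟩ _ ⟨y, hy, rfl⟩ hne hle
    exact hne (congrArg f (hM.1.eq hx hy ((hf x y).2 hle)))
  · obtain ⟨p, hp, -⟩ := hs q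
    obtain ⟨m, hm, hpm⟩ := hM.2 p
    exact ⟨f m, ⟨m, hm, rfl⟩, hp.trans ((hf p m).1 hpm)⟩

theorem IsMuSet.injOn {f : P → Q} (hf : ∀ x y, x ≤ y ↔ f x ≤ f y) {M : Set P}
    (hM : IsMuSet M) : Set.InjOn f M :=
  fun x hx y hy h => hM.1.eq hx hy ((hf x y).2 h.le)

/-- The map need not be injective, but it is so on antichains, so `μ`-sets keep their cardinality in
both directions. -/
theorem quasiorderHasType_iff_of_equivalence {f : P → Q} (hf : ∀ x y, x ≤ y ↔ f x ≤ f y)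
    (hs : ∀ q, ∃ p, q ≤ f p ∧ f p ≤ q) (t : UnificationType) :
    QuasiorderHasType P t ↔ QuasiorderHasType Q t := by
  choose g hg hg' using hs
  have hgle : ∀ x y, x ≤ y ↔ g x ≤ g y := fun x y =>
    ⟨fun h => (hf _ _).2 ((hg' x).trans (h.trans (hg y))),
      fun h => (hg x).trans (((hf _ _).1 h).trans (hg' y))⟩
  have hF : ∀ {M : Set P}, IsMuSet M → IsMuSet (f '' M) := fun hM =>
    hM.image hf fun q => ⟨g q, hg q, hg' q⟩
  have hG : ∀ {N : Set Q}, IsMuSet N → IsMuSet (g '' N) := fun hN =>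
    hN.image hgle fun p => ⟨f p, (hf _ _).2 (hg _), (hf _ _).2 (hg' _)⟩
  cases t
  · exact ⟨fun ⟨M, hM, h⟩ => ⟨_, hF hM, by rwa [(hM.injOn hf).ncard_image]⟩,
      fun ⟨N, hN, h⟩ => ⟨_, hG hN, by rwa [(hN.injOn hgle).ncard_image]⟩⟩
  · exact ⟨fun ⟨M, hM, h, k⟩ => ⟨_, hF hM, h.image f, by rwa [(hM.injOn hf).ncard_image]⟩,
      fun ⟨N, hN, h, k⟩ => ⟨_, hG hN, h.image g, by rwa [(hN.injOn hgle).ncard_image]⟩⟩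
  · exact ⟨fun ⟨M, hM, h⟩ => ⟨_, hF hM, h.image (hM.injOn hf)⟩,
      fun ⟨N, hN, h⟩ => ⟨_, hG hN, h.image (hN.injOn hgle)⟩⟩
  · exact not_congr ⟨fun ⟨M, hM⟩ => ⟨_, hF hM⟩, fun ⟨N, hN⟩ => ⟨_, hG hN⟩⟩

end Quasiorder

section Unification

variable {C : Type (u + 1)} [Category.{u} C] {FC : C → C → Type u} {CC : C → Type u}
  [∀ X Y, FunLike (FC X Y) (CC X) (CC Y)] [ConcreteCategory C FC] [HasTerms C]

theorem hasUnificationType_iff_of_quasiorderHasType_iff {V : Set C} {D : Type (u + 1)}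
    [Category.{u} D] {FD : D → D → Type u} {CD : D → Type u}
    [∀ X Y, FunLike (FD X Y) (CD X) (CD Y)] [ConcreteCategory D FD] [HasTerms D] {W : Set D}
    (h : ∀ A, IsUnifiableIn V A → ∃ L, IsUnifiableIn W L ∧
      ∀ t, QuasiorderHasType (Unifier V A) t ↔ QuasiorderHasType (Unifier W L) t)
    (k : ∀ L, IsUnifiableIn W L → ∃ A, IsUnifiableIn V A ∧
      ∀ t, QuasiorderHasType (Unifier V A) t ↔ QuasiorderHasType (Unifier W L) t)
    (t : UnificationType) : HasUnificationType V t ↔ HasUnificationType W t := by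
  have hall : ∀ p : (UnificationType → Prop) → Prop,
      (∀ A, IsUnifiableIn V A → p (QuasiorderHasType (Unifier V A))) ↔
        ∀ L, IsUnifiableIn W L → p (QuasiorderHasType (Unifier W L)) := by
    intro p
    constructor
    · intro H L hL
      obtain ⟨A, hA, e⟩ := k L hL
      rw [← funext fun t => propext (e t)]
      exact H A hA
    · intro H A hA
      obtain ⟨L, hL, e⟩ := h A hA
      rw [funext fun t => propext (e t)]
      exact H L hL
  have hex : ∀ s, (∃ A, IsUnifiableIn V A ∧ QuasiorderHasType (Unifier V A) s) ↔
      ∃ L, IsUnifiableIn W L ∧ QuasiorderHasType (Unifier W L) s := by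
    intro s
    -- The existential statement is the negation of an instance of `hall`.
    have := not_congr (hall fun q => ¬ q s)
    push Not at this
    exact this
  cases t
  · exact hall fun q => q .unitary
  · exact and_congr (hall fun q => q .unitary ∨ q .finitary) (hex _)
  · exact and_congr (hall fun q => q .unitary ∨ q .finitary ∨ q .infinitary) (hex _)
  · exact hex _

/-- A member of `V` mapping to a finitely presented algebra and containing its generators and
relations maps onto it. -/
theorem surjective_of_satisfies {V : Set C} {A S : C} (hA : A ∈ V) (hS : S ∈ V) {n : ℕ}
    {E : Set (HasTerms.Term C (Fin n) × HasTerms.Term C (Fin n))} {a : Fin n → CC A}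
    (ha : Satisfies A a E)
    (huniv : ∀ B ∈ V, ∀ b : Fin n → CC B, Satisfies B b E →
        ∃! h : A ⟶ B, ∀ i, ConcreteCategory.hom h (a i) = b i)
    (j : S ⟶ A) {s : Fin n → CC S} (hs : Satisfies S s E)
    (hj : ∀ i, ConcreteCategory.hom j (s i) = a i) :
    Function.Surjective (ConcreteCategory.hom j) := by
  obtain ⟨h, hh, -⟩ := huniv S hS s hs
  -- Both sides fix the generators, so `j` has a section.
  have h1 : h ≫ j = 𝟙 A := (huniv A hA a ha).unique
    (fun i => by rw [ConcreteCategory.comp_apply, hh, hj])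
    (fun i => ConcreteCategory.id_apply _)
  intro x
  exact ⟨ConcreteCategory.hom h x, by rw [← ConcreteCategory.comp_apply, h1]; simp⟩

end Unification

/-! ### Terms, and finite presentations by operation tables -/

theorem HeytTerm.map_eval {L M : Type u} [HeytingAlgebra L] [HeytingAlgebra M]
    (f : HeytingHom L M) {X : Type} (a : X → L) (t : HeytTerm X) :
    f (t.eval a) = t.eval fun x => f (a x) := by
  induction t with
  | var x => rfl
  | bot => exact map_bot f
  | top => exact map_top f
  | inf s t hs ht => simp only [eval, map_inf, hs, ht]
  | sup s t hs ht => simp only [eval, map_sup, hs, ht]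
  | imp s t hs ht => simp only [eval, map_himp, hs, ht]

theorem IntTerm.map_eval {A B : Type u} [InteriorAlgebra A] [InteriorAlgebra B]
    (f : InteriorHom A B) {X : Type} (a : X → A) (t : IntTerm X) :
    f.toFun (t.eval a) = t.eval fun x => f.toFun (a x) := by
  induction t with
  | var x => rfl
  | bot => exact f.map_bot
  | top => exact f.map_top
  | inf s t hs ht => simp only [eval, f.map_inf, hs, ht]
  | sup s t hs ht => simp only [eval, f.map_sup, hs, ht]
  | compl t ht => simp only [eval, f.map_compl, ht]
  | int t ht => simp only [eval, f.map_int, ht]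

/-- The operation tables of a Heyting algebra with elements named by `X`. -/
def heytDiagram {L : Type u} [HeytingAlgebra L] {X : Type} (e : L → X) :
    Set (HeytTerm X × HeytTerm X) :=
  {(.bot, .var (e ⊥)), (.top, .var (e ⊤))} ∪
  ((Set.range fun p : L × L => (.inf (.var (e p.1)) (.var (e p.2)), .var (e (p.1 ⊓ p.2)))) ∪
  ((Set.range fun p : L × L => (.sup (.var (e p.1)) (.var (e p.2)), .var (e (p.1 ⊔ p.2)))) ∪
  (Set.range fun p : L × L => (.imp (.var (e p.1)) (.var (e p.2)), .var (e (p.1 ⇨ p.2))))))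

/-- The operation tables of an interior algebra with elements named by `X`. -/
def intDiagram {B : Type u} [InteriorAlgebra B] {X : Type} (e : B → X) :
    Set (IntTerm X × IntTerm X) :=
  {(.bot, .var (e ⊥)), (.top, .var (e ⊤))} ∪
  ((Set.range fun p : B × B => (.inf (.var (e p.1)) (.var (e p.2)), .var (e (p.1 ⊓ p.2)))) ∪
  ((Set.range fun p : B × B => (.sup (.var (e p.1)) (.var (e p.2)), .var (e (p.1 ⊔ p.2)))) ∪
  ((Set.range fun a : B => (.compl (.var (e a)), .var (e aᶜ))) ∪
  (Set.range fun a : B => (.int (.var (e a)), .var (e (InteriorAlgebra.int a)))))))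

theorem heytDiagram_finite {L : Type u} [HeytingAlgebra L] [Finite L] {X : Type} (e : L → X) :
    (heytDiagram e).Finite :=
  (Set.toFinite _).union
    ((Set.finite_range _).union ((Set.finite_range _).union (Set.finite_range _)))

theorem intDiagram_finite {B : Type u} [InteriorAlgebra B] [Finite B] {X : Type} (e : B → X) :
    (intDiagram e).Finite :=
  (Set.toFinite _).union ((Set.finite_range _).union ((Set.finite_range _).union
    ((Set.finite_range _).union (Set.finite_range _))))

/-- All elements serve as generators and the operation tables as relations: a tuple satisfying them
is the same thing as a homomorphism. -/
theorem HeytAlg.isFinitelyPresentedIn_of_finite {W : Set HeytAlg.{u}} {L : HeytAlg.{u}}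
    (hL : L ∈ W) [Finite L] : IsFinitelyPresentedIn W L := by
  let e := Finite.equivFin L
  refine ⟨hL, Nat.card L, heytDiagram e, e.symm, heytDiagram_finite e, ?_, fun M hM b hb => ?_⟩
  · rintro _ ((rfl | rfl) | ⟨p, rfl⟩ | ⟨p, rfl⟩ | ⟨p, rfl⟩) <;>
      simp [HasTerms.eval, HeytTerm.eval]
  · let f : HeytingHom L M :=
      { toFun := fun x => b (e x)
        map_inf' := fun x y => (hb _ (.inr (.inl ⟨(x, y), rfl⟩))).symm
        map_sup' := fun x y => (hb _ (.inr (.inr (.inl ⟨(x, y), rfl⟩)))).symm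
        map_bot' := (hb _ (.inl (.inl rfl))).symm
        map_himp' := fun x y => (hb _ (.inr (.inr (.inr ⟨(x, y), rfl⟩)))).symm }
    refine ⟨HeytAlg.ofHom f, fun i => congrArg b (e.apply_symm_apply i), fun g hg => ?_⟩
    refine HeytAlg.ext fun x => ?_
    change g x = b (e x)
    simpa using hg (e x)

theorem IntAlg.isFinitelyPresentedIn_of_finite {V : Set IntAlg.{u}} {A : IntAlg.{u}}
    (hA : A ∈ V) [Finite A] : IsFinitelyPresentedIn V A := by
  let e := Finite.equivFin A
  refine ⟨hA, Nat.card A, intDiagram e, e.symm, intDiagram_finite e, ?_, fun B hB b hb => ?_⟩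
  · rintro _ ((rfl | rfl) | ⟨p, rfl⟩ | ⟨p, rfl⟩ | ⟨p, rfl⟩ | ⟨p, rfl⟩) <;>
      simp [HasTerms.eval, IntTerm.eval]
  · let f : InteriorHom A B :=
      { toFun := fun x => b (e x)
        map_bot := (hb _ (.inl (.inl rfl))).symm
        map_top := (hb _ (.inl (.inr rfl))).symm
        map_inf := fun x y => (hb _ (.inr (.inl ⟨(x, y), rfl⟩))).symm
        map_sup := fun x y => (hb _ (.inr (.inr (.inl ⟨(x, y), rfl⟩)))).symm
        map_compl := fun x => (hb _ (.inr (.inr (.inr (.inl ⟨x, rfl⟩))))).symm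
        map_int := fun x => (hb _ (.inr (.inr (.inr (.inr ⟨x, rfl⟩))))).symm }
    refine ⟨f, fun i => congrArg b (e.apply_symm_apply i), fun g hg => ?_⟩
    refine InteriorHom.ext (funext fun x => ?_)
    exact (congrArg g.toFun (e.symm_apply_apply x).symm).trans (hg (e x))

/-! ### Transfer of unification along the passage to open elements -/

namespace IntAlg

open InteriorAlgebra

/-- The action of `openAlgebra` on homomorphisms. -/
def openMap {A B : IntAlg.{u}} (f : A ⟶ B) : openAlgebra A ⟶ openAlgebra B :=
  HeytAlg.ofHom (openHom f)

theorem openMap_comp {A B D : IntAlg.{u}} (f : A ⟶ B) (g : B ⟶ D) :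
    openMap (f ≫ g) = openMap f ≫ openMap g := rfl

variable {V : Set IntAlg.{u}}

theorem openMap_injective {A B : IntAlg.{u}} (hA : IsStarAlgebra A) {f g : A ⟶ B}
    (h : openMap f = openMap g) : f = g :=
  openHom_injective hA (congrArg HeytAlg.Hom.hom h)

theorem openMap_surjective {A B : IntAlg.{u}} (hA : IsStarAlgebra A)
    (φ : openAlgebra A ⟶ openAlgebra B) : ∃ f : A ⟶ B, openMap f = φ := by
  obtain ⟨f, hf⟩ := openHom_surjective hA φ.hom
  exact ⟨f, HeytAlg.hom_ext hf⟩

theorem surjective_openMap_iff {A B : IntAlg.{u}} (hB : IsStarAlgebra B) (f : A ⟶ B) :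
    Function.Surjective (ConcreteCategory.hom (openMap f)) ↔
      Function.Surjective (ConcreteCategory.hom f) :=
  openHom_surjective_iff hB f

theorem isFinitelyPresentedIn_iff (hV : IsVariety V) (hfin : IsLocallyFinite V)
    {A : IntAlg.{u}} : IsFinitelyPresentedIn V A ↔ A ∈ V ∧ Finite A := by
  refine ⟨fun ⟨hA, n, E, a, hE, ha, huniv⟩ => ⟨hA, ?_⟩,
    fun ⟨hA, _⟩ => isFinitelyPresentedIn_of_finite hA⟩
  have hT := isSubalgebra_generated (Set.range a)
  have hTV : hT.toIntAlg ∈ V := hV.sub_mem A hA _ hT.incl hT.incl_injective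
  have : Finite hT.toIntAlg := (hfin A hA _ (Set.finite_range a)).to_subtype
  refine Finite.of_surjective _ (surjective_of_satisfies hA hTV ha huniv hT.incl
    (s := fun i => ⟨a i, subset_generated _ ⟨i, rfl⟩⟩) (fun p hp => ?_) fun i => rfl)
  refine hT.incl_injective ?_
  let s : Fin n → hT.toIntAlg := fun i => ⟨a i, subset_generated _ ⟨i, rfl⟩⟩
  exact (IntTerm.map_eval hT.incl s p.1).trans
    ((ha p hp).trans (IntTerm.map_eval hT.incl s p.2).symm)

/-- Closure of `gamma V` under subalgebras is not needed. The generators of `L`, seen as open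
elements of `A`, generate a finite interior subalgebra; its open elements form a finite member of
`gamma V` that embeds in `L` and contains the generators, hence is mapped onto `L`. -/
theorem isFinitelyPresentedIn_gamma_iff (hV : IsVariety V) (hfin : IsLocallyFinite V)
    {L : HeytAlg.{u}} : IsFinitelyPresentedIn (gamma V) L ↔ L ∈ gamma V ∧ Finite L := by
  refine ⟨fun ⟨hL, n, E, a, hE, ha, huniv⟩ => ⟨hL, ?_⟩,
    fun ⟨hL, _⟩ => HeytAlg.isFinitelyPresentedIn_of_finite hL⟩
  obtain ⟨A, hA, ⟨i⟩⟩ := id hL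
  let c : Fin n → opens A := fun k => i.hom (a k)
  have hT := isSubalgebra_generated (Set.range fun k => (c k : A))
  have hTV : hT.toIntAlg ∈ V := hV.sub_mem A hA _ hT.incl hT.incl_injective
  have : Finite hT.toIntAlg :=
    (hfin A hA _ (Set.finite_range fun k => (c k : A))).to_subtype
  have : Finite (openAlgebra hT.toIntAlg) := Subtype.finite
  let j : openAlgebra hT.toIntAlg ⟶ L := openMap hT.incl ≫ i.inv
  have hj : Function.Injective j := by
    intro x y h
    have h1 : openMap hT.incl x = openMap hT.incl y := by
      have := congrArg i.hom h
      simpa [j] using this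
    exact Subtype.ext (hT.incl_injective (congrArg (fun z : opens A => (z : A)) h1))
  have hjc : ∀ k, j ⟨⟨c k, subset_generated _ ⟨k, rfl⟩⟩, Subtype.ext (c k).2⟩ = a k := by
    intro k
    change i.inv (i.hom (a k)) = a k
    simp
  refine Finite.of_surjective _ (surjective_of_satisfies hL ⟨_, hTV, ⟨Iso.refl _⟩⟩ ha huniv j
    (s := fun k => ⟨⟨c k, subset_generated _ ⟨k, rfl⟩⟩, Subtype.ext (c k).2⟩)
    (fun p hp => hj ?_) hjc)
  refine (HeytTerm.map_eval j.hom _ p.1).trans (Eq.trans ?_ (HeytTerm.map_eval j.hom _ p.2).symm)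
  have hfun : (fun k => j.hom ⟨⟨c k, subset_generated _ ⟨k, rfl⟩⟩, Subtype.ext (c k).2⟩) = a :=
    funext hjc
  erw [hfun]
  exact ha p hp

theorem finite_iff_of_iso_openAlgebra (hfin : IsLocallyFinite V)
    (hstar : ∀ A ∈ V, IsStarAlgebra A) {A : IntAlg.{u}} (hA : A ∈ V) {L : HeytAlg.{u}}
    (i : L ≅ openAlgebra A) : Finite L ↔ Finite A := by
  have e : L ≃ opens A := Equiv.ofBijective _ (ConcreteCategory.bijective_of_isIso i.hom)
  rw [e.finite_iff]
  refine ⟨fun h => ?_, fun h => Subtype.finite⟩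
  -- The finitely many open elements generate all of `A`.
  have := hfin A hA (opens A) h
  rwa [hstar A hA, Set.finite_univ_iff] at this

theorem isFinitelyPresentedIn_gamma_iff_of_iso (hV : IsVariety V) (hfin : IsLocallyFinite V)
    (hstar : ∀ A ∈ V, IsStarAlgebra A) {A : IntAlg.{u}} (hA : A ∈ V) {L : HeytAlg.{u}}
    (i : L ≅ openAlgebra A) :
    IsFinitelyPresentedIn (gamma V) L ↔ IsFinitelyPresentedIn V A := by
  rw [isFinitelyPresentedIn_gamma_iff hV hfin, isFinitelyPresentedIn_iff hV hfin,
    finite_iff_of_iso_openAlgebra hfin hstar hA i]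
  exact and_congr_left fun _ => iff_of_true ⟨A, hA, ⟨i⟩⟩ hA

theorem isProjectiveIn_gamma_iff_of_iso (hstar : ∀ A ∈ V, IsStarAlgebra A) {P : IntAlg.{u}}
    (hP : P ∈ V) {L : HeytAlg.{u}} (i : L ≅ openAlgebra P) :
    IsProjectiveIn (gamma V) L ↔ IsProjectiveIn V P := by
  constructor
  · refine fun h => ⟨hP, fun A hA B hB e f he => ?_⟩
    obtain ⟨g, hg⟩ := h.2 _ ⟨A, hA, ⟨Iso.refl _⟩⟩ _ ⟨B, hB, ⟨Iso.refl _⟩⟩ (openMap e)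
      (i.hom ≫ openMap f) ((surjective_openMap_iff (hstar B hB) e).2 he)
    obtain ⟨g', hg'⟩ := openMap_surjective (hstar P hP) (i.inv ≫ g)
    refine ⟨g', openMap_injective (hstar P hP) ?_⟩
    rw [openMap_comp, hg', Category.assoc, hg, Iso.inv_hom_id_assoc]
  · refine fun h => ⟨⟨P, hP, ⟨i⟩⟩, ?_⟩
    rintro K ⟨A, hA, ⟨iA⟩⟩ M ⟨B, hB, ⟨iB⟩⟩ e f he
    obtain ⟨e', he'⟩ := openMap_surjective (hstar A hA) (iA.inv ≫ e ≫ iB.hom)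
    obtain ⟨f', hf'⟩ := openMap_surjective (hstar P hP) (i.inv ≫ f ≫ iB.hom)
    have hsurj : Function.Surjective (ConcreteCategory.hom e') := by
      rw [← surjective_openMap_iff (hstar B hB), he']
      exact (ConcreteCategory.bijective_of_isIso iB.hom).2.comp
        (he.comp (ConcreteCategory.bijective_of_isIso iA.inv).2)
    obtain ⟨g, hg⟩ := h.2 A hA B hB e' f' hsurj
    refine ⟨i.hom ≫ openMap g ≫ iA.inv, ?_⟩
    have h1 : openMap g ≫ iA.inv ≫ e ≫ iB.hom = i.inv ≫ f ≫ iB.hom := by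
      rw [← he', ← hf', ← hg, openMap_comp]
    rw [← cancel_mono iB.hom, ← cancel_epi i.inv]
    simpa using h1

/-- Transport of unifiers from `V` to `γ(V)`. -/
def openUnifier (hV : IsVariety V) (hfin : IsLocallyFinite V)
    (hstar : ∀ A ∈ V, IsStarAlgebra A) {A : IntAlg.{u}} {L : HeytAlg.{u}}
    (i : L ≅ openAlgebra A) (v : Unifier V A) : Unifier (gamma V) L where
  target := openAlgebra v.target
  finitelyPresented := (isFinitelyPresentedIn_gamma_iff_of_iso hV hfin hstar
    v.finitelyPresented.1 (Iso.refl _)).2 v.finitelyPresented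
  projective := (isProjectiveIn_gamma_iff_of_iso hstar v.finitelyPresented.1 (Iso.refl _)).2
    v.projective
  hom := i.hom ≫ openMap v.hom

theorem openUnifier_le_iff (hV : IsVariety V) (hfin : IsLocallyFinite V)
    (hstar : ∀ A ∈ V, IsStarAlgebra A) {A : IntAlg.{u}} (hA : A ∈ V) {L : HeytAlg.{u}}
    (i : L ≅ openAlgebra A) (v w : Unifier V A) :
    v ≤ w ↔ openUnifier hV hfin hstar i v ≤ openUnifier hV hfin hstar i w := by
  constructor
  · rintro ⟨h, hh⟩
    refine ⟨openMap h, ?_⟩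
    change (i.hom ≫ openMap w.hom) ≫ openMap h = i.hom ≫ openMap v.hom
    rw [Category.assoc, ← openMap_comp, hh]
  · rintro ⟨h, hh⟩
    obtain ⟨h', rfl⟩ := openMap_surjective (hstar _ w.finitelyPresented.1) h
    refine ⟨h', openMap_injective (hstar A hA) ?_⟩
    change (i.hom ≫ openMap w.hom) ≫ openMap h' = i.hom ≫ openMap v.hom at hh
    rwa [Category.assoc, cancel_epi, ← openMap_comp] at hh

/-- The target of `w` is isomorphic to the open elements of some `B` in `V`, and fullness lifts `w`
to a unifier into `B`; the isomorphism gives both comparisons. -/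
theorem exists_openUnifier_equiv (hV : IsVariety V) (hfin : IsLocallyFinite V)
    (hstar : ∀ A ∈ V, IsStarAlgebra A) {A : IntAlg.{u}} (hA : A ∈ V) {L : HeytAlg.{u}}
    (i : L ≅ openAlgebra A) (w : Unifier (gamma V) L) :
    ∃ v : Unifier V A, w ≤ openUnifier hV hfin hstar i v ∧
      openUnifier hV hfin hstar i v ≤ w := by
  obtain ⟨M, hM, hM', f⟩ := w
  obtain ⟨B, hB, ⟨iB⟩⟩ := id hM.1
  obtain ⟨f', hf'⟩ := openMap_surjective (hstar A hA) (i.inv ≫ f ≫ iB.hom)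
  refine ⟨⟨B, (isFinitelyPresentedIn_gamma_iff_of_iso hV hfin hstar hB iB).1 hM,
    (isProjectiveIn_gamma_iff_of_iso hstar hB iB).1 hM', f'⟩, ⟨iB.inv, ?_⟩, ⟨iB.hom, ?_⟩⟩
  · change (i.hom ≫ openMap f') ≫ iB.inv = f
    simp [hf']
  · change f ≫ iB.hom = i.hom ≫ openMap f'
    simp [hf']

theorem quasiorderHasType_unifier_iff (hV : IsVariety V) (hfin : IsLocallyFinite V)
    (hstar : ∀ A ∈ V, IsStarAlgebra A) {A : IntAlg.{u}} (hA : A ∈ V) {L : HeytAlg.{u}}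
    (i : L ≅ openAlgebra A) (t : UnificationType) :
    QuasiorderHasType (Unifier V A) t ↔ QuasiorderHasType (Unifier (gamma V) L) t :=
  quasiorderHasType_iff_of_equivalence (openUnifier_le_iff hV hfin hstar hA i)
    (exists_openUnifier_equiv hV hfin hstar hA i) t

theorem isUnifiableIn_gamma_iff_of_iso (hV : IsVariety V) (hfin : IsLocallyFinite V)
    (hstar : ∀ A ∈ V, IsStarAlgebra A) {A : IntAlg.{u}} (hA : A ∈ V) {L : HeytAlg.{u}}
    (i : L ≅ openAlgebra A) : IsUnifiableIn V A ↔ IsUnifiableIn (gamma V) L :=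
  and_congr (isFinitelyPresentedIn_gamma_iff_of_iso hV hfin hstar hA i).symm
    ⟨fun ⟨v⟩ => ⟨openUnifier hV hfin hstar i v⟩,
      fun ⟨w⟩ => ⟨(exists_openUnifier_equiv hV hfin hstar hA i w).choose⟩⟩

theorem unificationType_gamma (hV : IsVariety V) (hfin : IsLocallyFinite V)
    (hstar : ∀ A ∈ V, IsStarAlgebra A) : unificationType V = unificationType (gamma V) := by
  rw [unificationType_eq_iff]
  refine (hasUnificationType_iff_of_quasiorderHasType_iff (fun A hA => ?_) (fun L hL => ?_) _).2
    ((unificationType_eq_iff _ _).1 rfl)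
  · have i : openAlgebra A ≅ openAlgebra A := Iso.refl _
    exact ⟨_, (isUnifiableIn_gamma_iff_of_iso hV hfin hstar hA.1.1 i).1 hA,
      quasiorderHasType_unifier_iff hV hfin hstar hA.1.1 i⟩
  · obtain ⟨A, hA, ⟨i⟩⟩ := hL.1.1
    exact ⟨A, (isUnifiableIn_gamma_iff_of_iso hV hfin hstar hA i).2 hL,
      quasiorderHasType_unifier_iff hV hfin hstar hA i⟩

end IntAlg

theorem mainTheorem3 (V : Set IntAlg.{u}) (hV : IntAlg.IsVariety V)
    (hfin : IntAlg.IsLocallyFinite V) :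
    (IntAlg.IsStarVariety V ↔ ∀ A ∈ V, InteriorAlgebra.IsGrzegorczyk A) ∧
    (IntAlg.IsStarVariety V → unificationType V = unificationType (IntAlg.gamma V)) := by
  have h := fun h : ∀ A ∈ V, InteriorAlgebra.IsGrzegorczyk A => hV.isStarAlgebra hfin h
  exact ⟨⟨fun hs => hs.isGrzegorczyk, fun hg => hV.isStarVariety (h hg)⟩,
    fun hs => IntAlg.unificationType_gamma hV hfin (h hs.isGrzegorczyk)⟩
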